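/- Let $1\le k\le d$ be integers. Let $\mathcal{G}_{k,d}=\{P\in\mathbb{R}^{d\times d}: P^\top=P,\ P^2=P,\ \operatorname{trace}(P)=k\}$ be the Grassmann space of rank-$k$ orthogonal projections on $\mathbb{R}^d$, and let $\sigma_{k,d}$ be the orthogonally invariant probability measure on $\mathcal{G}_{k,d}$ induced by the normalized Haar measure on the orthogonal group $\mathcal{O}(d)$ through the action $P\mapsto UPU^\top$. For a symmetric matrix $M\in\mathbb{R}^{d\times d}$ and an integer $s\ge 1$, let $$\mu^s_{k,d}(M)=\int_{\mathcal{G}_{k,d}}\operatorname{trace}(PM)^s\,d\sigma_{k,d}(P)$$ be the $s$-th Grassmannian trace moment, and for $x,y\in\mathbb{R}^d$ put $E_{x,y}=\tfrac12(xy^\top+yx^\top)$. Let $\mathbb{S}^{d-1}$ denote the Euclidean unit sphere of $\mathbb{R}^d$. **Theorem.** Let $t\ge 1$ be an integer and let $\alpha\in\mathbb{N}^d$ (zero entries allowed) with $|\alpha|=\alpha_1+\cdots+\alpha_d=t$. Then there are a natural number $m$, points $y^\alpha_{s,i}\in\mathbb{S}^{d-1}$ and coefficients $f^\alpha_{s,i}\in\mathbb{R}$,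 for $s=1,\ldots,t$ and $i=1,\ldots,m$, such that $$x^\alpha=\prod_{j=1}^d x_j^{\alpha_j}=\sum_{s=1}^t\sum_{i=1}^m f^\alpha_{s,i}\,\mu^s_{k,d}\bigl(E_{x,y^\alpha_{s,i}}\bigr)\qquad\text{for all } x\in\mathbb{S}^{d-1}.$$ -/

import Mathlib

noncomputable section

namespace GrassmannMoment

open MeasureTheory

/-- The Grassmann space: symmetric real `d × d` matrices `P` with `P² = P` and `trace P = k`. -/
def grassmannian (k d : ℕ) : Set (Matrix (Fin d) (Fin d) ℝ) :=
  {P | P.transpose = P ∧ P * P = P ∧ P.trace = (k : ℝ)}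

/-- The diagonal matrix whose first `k` diagonal entries are one, the others being zero. -/
def diagProj (k d : ℕ) : Matrix (Fin d) (Fin d) ℝ :=
  Matrix.diagonal fun i => if (i : ℕ) < k then 1 else 0

theorem diagProj_mem {k d : ℕ} (hkd : k ≤ d) : diagProj k d ∈ grassmannian k d := by
  refine ⟨by simp [diagProj], ?_, ?_⟩
  · rw [diagProj, Matrix.diagonal_mul_diagonal]
    congr 1
    funext i
    split_ifs <;> simp
  · rw [diagProj, Matrix.trace_diagonal, Finset.sum_boole]
    congr 1
    have : (Finset.univ.filter fun i : Fin d => (i : ℕ) < k).card = min d k :=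
      Fin.card_filter_val_lt
    rw [this, min_eq_right hkd]

theorem conj_mem {k d : ℕ} {P : Matrix (Fin d) (Fin d) ℝ} (hP : P ∈ grassmannian k d)
    {U : Matrix (Fin d) (Fin d) ℝ} (hU : U ∈ Matrix.orthogonalGroup (Fin d) ℝ) :
    U * P * U.transpose ∈ grassmannian k d := by
  obtain ⟨h1, h2, h3⟩ := hP
  have hU' : U.transpose * U = 1 := (Matrix.mem_orthogonalGroup_iff' (Fin d) ℝ).1 hU
  refine ⟨?_, ?_, ?_⟩
  · simp [Matrix.transpose_mul, h1, Matrix.mul_assoc]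
  · calc U * P * U.transpose * (U * P * U.transpose)
        = U * P * (U.transpose * U) * P * U.transpose := by simp only [Matrix.mul_assoc]
      _ = U * (P * P) * U.transpose := by rw [hU', Matrix.mul_one]; simp only [Matrix.mul_assoc]
      _ = U * P * U.transpose := by rw [h2]
  · rw [Matrix.trace_mul_comm, ← Matrix.mul_assoc, hU', Matrix.one_mul, h3]

instance compactSpace_orthogonalGroup (d : ℕ) :
    CompactSpace (Matrix.orthogonalGroup (Fin d) ℝ) := by
  apply isCompact_iff_compactSpace.1
  have hc : IsCompact (Set.univ.pi fun _ : Fin d => Set.univ.pi fun _ : Fin d =>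
      Metric.closedBall (0 : ℝ) 1) :=
    isCompact_univ_pi fun _ => isCompact_univ_pi fun _ => isCompact_closedBall 0 1
  refine hc.of_isClosed_subset ?_ ?_
  · have : ((Matrix.orthogonalGroup (Fin d) ℝ : Set (Matrix (Fin d) (Fin d) ℝ)))
        = {A | A * A.transpose = 1} := by
      ext A
      exact Matrix.mem_orthogonalGroup_iff (Fin d) ℝ
    rw [this]
    exact isClosed_eq (continuous_id.matrix_mul continuous_id.matrix_transpose)
      continuous_const
  · intro A hA
    simp only [Set.mem_pi, Set.mem_univ, true_imp_iff, mem_closedBall_zero_iff]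
    exact fun i j => entry_norm_bound_of_unitary hA i j

instance orthogonalMeasurableSpace (d : ℕ) : MeasurableSpace (Matrix.orthogonalGroup (Fin d) ℝ) := borel _

instance orthogonalBorelSpace (d : ℕ) : BorelSpace (Matrix.orthogonalGroup (Fin d) ℝ) := ⟨rfl⟩

instance grassmannianMeasurableSpace (k d : ℕ) : MeasurableSpace (grassmannian k d) := borel _

instance grassmannianBorelSpace (k d : ℕ) : BorelSpace (grassmannian k d) := ⟨rfl⟩

/-- The normalized Haar measure (total mass one) on the compact group `O(d)`. -/
def haarO (d : ℕ) : Measure (Matrix.orthogonalGroup (Fin d) ℝ) :=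
  Measure.haarMeasure ⊤

/-- The orbit map `U ↦ U D Uᵀ` from `O(d)` to the Grassmannian, where `D = diagProj k d`. -/
def orbitMap {k d : ℕ} (hkd : k ≤ d) (U : Matrix.orthogonalGroup (Fin d) ℝ) :
    grassmannian k d :=
  ⟨U.1 * diagProj k d * U.1.transpose, conj_mem (diagProj_mem hkd) U.2⟩

/-- The orthogonally invariant probability measure on the Grassmannian induced by the Haar
measure on `O(d)`, that is, its image under the (continuous, surjective) orbit map. -/
def grassmannMeasure {k d : ℕ} (hkd : k ≤ d) : Measure (grassmannian k d) :=
  (haarO d).map (orbitMap hkd)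

/-- The trace moment `∫ ⟨P, M₁⟩ ⋯ ⟨P, M_t⟩ dσ(P)` with the trace inner product
`⟨P, M⟩ = trace (P M)`. -/
def multiTraceMoment {k d : ℕ} (hkd : k ≤ d) {t : ℕ}
    (M : Fin t → Matrix (Fin d) (Fin d) ℝ) : ℝ :=
  ∫ P : grassmannian k d, ∏ i, (P.1 * M i).trace ∂(grassmannMeasure hkd)

/-- The `t`-th trace moment of a single matrix `M`, repeated `t` times. -/
def traceMoment {k d : ℕ} (hkd : k ≤ d) (t : ℕ) (M : Matrix (Fin d) (Fin d) ℝ) : ℝ :=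
  multiTraceMoment hkd fun _ : Fin t => M

/-- The symmetric matrix `E_{x,y} = (x yᵀ + y xᵀ) / 2`. -/
def symmOuter {d : ℕ} (x y : EuclideanSpace ℝ (Fin d)) : Matrix (Fin d) (Fin d) ℝ :=
  (1 / 2 : ℝ) • (Matrix.vecMulVec x.ofLp y.ofLp + Matrix.vecMulVec y.ofLp x.ofLp)

end GrassmannMoment

end

/-! By orthogonal invariance the moment of `symmOuter x y` sees only the eigenvalues of that matrix.
For unit vectors these are `(⟪x, y⟫ ± 1) / 2`, together with zeros, so the `s`-th moment is a
polynomial in `⟪x, y⟫` with positive leading coefficient (`exists_traceMoment_symmOuter_eq`). This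
triangular system is inverted by induction on `s`, putting every `⟪·, y⟫ ^ s` in the span of the
moments (`sphereInner_pow_mem_momentSpan`); the constant terms are handled by antipodal points and
`∑ xᵢ² = 1`. Polarization (`prod_pow_mem_span_pow`) then writes a monomial of degree `t` through
`t`-th powers of linear forms. -/

namespace GrassmannMoment

open MeasureTheory Matrix

/-! ### Moments as polynomials in the inner product -/

section Moments

variable {k d : ℕ}

/-- The orbit point `U D Uᵀ` as a matrix. -/
def orbitMatrix (k : ℕ) (U : orthogonalGroup (Fin d) ℝ) : Matrix (Fin d) (Fin d) ℝ :=
  U.1 * diagProj k d * U.1.transpose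

theorem continuous_orbitMatrix : Continuous (orbitMatrix k (d := d)) := by
  unfold orbitMatrix
  exact (continuous_subtype_val.matrix_mul continuous_const).matrix_mul
    continuous_subtype_val.matrix_transpose

theorem orbitMatrix_mul (V U : orthogonalGroup (Fin d) ℝ) :
    orbitMatrix k (V * U) = V.1 * orbitMatrix k U * V.1.transpose := by
  simp [orbitMatrix, transpose_mul, Matrix.mul_assoc]

instance isHaarMeasure_haarO : (haarO d).IsHaarMeasure := by
  unfold haarO
  infer_instance

theorem traceMoment_eq (hkd : k ≤ d) (s : ℕ) (M : Matrix (Fin d) (Fin d) ℝ) :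
    traceMoment hkd s M = ∫ U, (orbitMatrix k U * M).trace ^ s ∂(haarO d) := by
  have hc : Continuous (orbitMap hkd) := continuous_orbitMatrix.subtype_mk _
  unfold traceMoment multiTraceMoment grassmannMeasure
  rw [integral_map hc.measurable.aemeasurable]
  · simp [orbitMap, orbitMatrix]
  · refine Continuous.aestronglyMeasurable ?_
    refine continuous_finsetProd _ fun _ _ => ?_
    exact (continuous_subtype_val.matrix_mul continuous_const).matrix_trace

/-- Cyclicity of the trace moves the conjugation onto the orbit point, where left invariance of Haar
measure absorbs it. -/
theorem traceMoment_conj (hkd : k ≤ d) (s : ℕ) (M : Matrix (Fin d) (Fin d) ℝ)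
    (V : orthogonalGroup (Fin d) ℝ) :
    traceMoment hkd s (V.1 * M * V.1.transpose) = traceMoment hkd s M := by
  rw [traceMoment_eq, traceMoment_eq,
    ← integral_mul_left_eq_self (fun U => (orbitMatrix k U * M).trace ^ s) V⁻¹]
  congr 1
  funext U
  have h : ((V⁻¹ : orthogonalGroup (Fin d) ℝ) : Matrix (Fin d) (Fin d) ℝ) = V.1.transpose := by
    ext i j
    simp
  rw [orbitMatrix_mul, h, transpose_transpose]
  simp only [Matrix.mul_assoc]
  rw [trace_mul_comm V.1.transpose]
  simp only [Matrix.mul_assoc]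

end Moments

/-- Every symmetric rank-two matrix `E_{x,y}` is a difference of multiples of two orthogonal
rank-one projections. -/
theorem exists_symmOuter_eq_conj {d : ℕ} {i₀ i₁ : Fin d} (hi : i₀ ≠ i₁)
    (x y : EuclideanSpace ℝ (Fin d)) (hx : ‖x‖ = 1) (hy : ‖y‖ = 1) :
    ∃ V : orthogonalGroup (Fin d) ℝ, symmOuter x y =
      V.1 * (((1 + inner ℝ x y) / 2) • single i₀ i₀ (1 : ℝ) -
        ((1 - inner ℝ x y) / 2) • single i₁ i₁ (1 : ℝ)) * V.1.transpose := by
  -- Equal norms make `a` and `b` orthogonal, and `E_{x,y} = (a aᵀ - b bᵀ) / 4`.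
  set a := x + y with ha
  set b := x - y with hb
  have hab : inner ℝ a b = 0 := by
    rw [ha, hb, real_inner_add_sub_eq_zero_iff, hx, hy]
  have ha2 : ‖a‖ ^ 2 = 2 + 2 * inner ℝ x y := by
    rw [ha, norm_add_sq_real, hx, hy]; ring
  have hb2 : ‖b‖ ^ 2 = 2 - 2 * inner ℝ x y := by
    rw [hb, norm_sub_sq_real, hx, hy]; ring
  let v : Fin d → EuclideanSpace ℝ (Fin d) := fun i => if i = i₀ then ‖a‖⁻¹ • a else ‖b‖⁻¹ • b
  -- If `x = ±y`, one of `a`, `b` vanishes; its index is left free for the basis extension.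
  have hv : Orthonormal ℝ (Set.domRestrict {i | (i = i₀ ∧ a ≠ 0) ∨ (i = i₁ ∧ b ≠ 0)} v) := by
    constructor
    · rintro ⟨i, ⟨rfl, h⟩ | ⟨rfl, h⟩⟩
      · simp [v, norm_smul, h]
      · simp [v, hi.symm, norm_smul, h]
    · rintro ⟨i, ⟨rfl, h⟩ | ⟨rfl, h⟩⟩ ⟨j, ⟨rfl, h'⟩ | ⟨rfl, h'⟩⟩ hij
      · exact absurd rfl hij
      · simp [v, hi.symm, inner_smul_left, inner_smul_right, hab]
      · simp [v, hi.symm, inner_smul_left, inner_smul_right, real_inner_comm, hab]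
      · exact absurd rfl hij
  obtain ⟨B, hB⟩ := hv.exists_orthonormalBasis_extension_of_card_eq (by simp)
  have hBa : a = ‖a‖ • B i₀ := by
    by_cases h : a = 0
    · simp [h]
    · rw [hB i₀ (Or.inl ⟨rfl, h⟩)]
      simp [v, smul_smul, h]
  have hBb : b = ‖b‖ • B i₁ := by
    by_cases h : b = 0
    · simp [h]
    · rw [hB i₁ (Or.inr ⟨rfl, h⟩)]
      simp [v, smul_smul, h, hi.symm]
  refine ⟨⟨(EuclideanSpace.basisFun (Fin d) ℝ).toBasis.toMatrix B,
    OrthonormalBasis.toMatrix_orthonormalBasis_mem_orthogonal _ _⟩, ?_⟩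
  have ent : ∀ i j, (EuclideanSpace.basisFun (Fin d) ℝ).toBasis.toMatrix B i j = B j i := by
    intro i j
    simp [Module.Basis.toMatrix_apply]
  ext i j
  have e1 : ∀ l, x l + y l = ‖a‖ * B i₀ l := fun l => by
    simpa [ha] using congrArg (fun z : EuclideanSpace ℝ (Fin d) => z l) hBa
  have e2 : ∀ l, x l - y l = ‖b‖ * B i₁ l := fun l => by
    simpa [hb] using congrArg (fun z : EuclideanSpace ℝ (Fin d) => z l) hBb
  have key : ∀ (V : Matrix (Fin d) (Fin d) ℝ) (l : Fin d),
      (V * single l l (1 : ℝ) * V.transpose) i j = V i l * V j l := by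
    intro V l
    simp [Matrix.mul_apply, single_apply, Finset.sum_ite_eq, ite_and]
  rw [Matrix.mul_sub, Matrix.sub_mul, Matrix.mul_smul, Matrix.mul_smul, Matrix.smul_mul,
    Matrix.smul_mul, Matrix.sub_apply, Matrix.smul_apply, Matrix.smul_apply, key, key]
  simp only [ent, symmOuter, Matrix.smul_apply, Matrix.add_apply, vecMulVec_apply, smul_eq_mul]
  have h1 : (1 + inner ℝ x y) / 2 = ‖a‖ ^ 2 / 4 := by rw [ha2]; ring
  have h2 : (1 - inner ℝ x y) / 2 = ‖b‖ ^ 2 / 4 := by rw [hb2]; ring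
  rw [h1, h2]
  have p1 : ‖a‖ ^ 2 / 4 * (B i₀ i * B i₀ j) = (x i + y i) * (x j + y j) / 4 := by
    rw [e1, e1]; ring
  have p2 : ‖b‖ ^ 2 / 4 * (B i₁ i * B i₁ j) = (x i - y i) * (x j - y j) / 4 := by
    rw [e2, e2]; ring
  rw [p1, p2]
  ring

theorem trace_mul_single {d : ℕ} (P : Matrix (Fin d) (Fin d) ℝ) (l : Fin d) :
    (P * single l l (1 : ℝ)).trace = P l l := by
  simp [Matrix.trace, Matrix.mul_apply, single_apply, ite_and]

theorem orbitMatrix_apply_self_nonneg {k d : ℕ} (U : orthogonalGroup (Fin d) ℝ) (l : Fin d) :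
    0 ≤ orbitMatrix k U l l := by
  simp only [orbitMatrix, diagProj, Matrix.mul_apply, diagonal_apply, transpose_apply]
  refine Finset.sum_nonneg fun i _ => ?_
  simp only [mul_ite, mul_one, mul_zero, Finset.sum_ite_eq', Finset.mem_univ, if_true, ite_mul,
    zero_mul]
  split_ifs
  · exact mul_self_nonneg _
  · exact le_rfl

/-- On pairs of unit vectors the `s`-th trace moment of `E_{x,y}` is a polynomial in `⟪x, y⟫` of
degree exactly `s`. -/
theorem exists_traceMoment_symmOuter_eq {k d : ℕ} (hk : 1 ≤ k) (hkd : k ≤ d) (s : ℕ) :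
    ∃ a : ℕ → ℝ, 0 < a s ∧ (Even s → 0 ≤ a 0) ∧
      ∀ x y : EuclideanSpace ℝ (Fin d), ‖x‖ = 1 → ‖y‖ = 1 →
        traceMoment hkd s (symmOuter x y) =
          ∑ j ∈ Finset.range (s + 1), a j * (inner ℝ x y) ^ j := by
  have hd : 0 < d := by omega
  let i₀ : Fin d := ⟨0, hd⟩
  have hpos : 0 < orbitMatrix k (1 : orthogonalGroup (Fin d) ℝ) i₀ i₀ := by
    have hk0 : 0 < k := hk
    simp [orbitMatrix, diagProj, i₀, hk0]
  -- There is no second index when `d = 1`; the only projection is then the identity.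
  by_cases hd1 : d = 1
  · subst hd1
    obtain rfl : k = 1 := by omega
    refine ⟨fun j => if j = s then 1 else 0, by simp, fun _ => by dsimp only; split_ifs <;> simp,
      fun x y hx hy => ?_⟩
    rw [traceMoment_eq]
    have h : ∀ U : orthogonalGroup (Fin 1) ℝ,
        (orbitMatrix 1 U * symmOuter x y).trace ^ s = inner ℝ x y ^ s := by
      intro U
      have hP := (conj_mem (diagProj_mem hkd) U.2).2.2
      have h1 : orbitMatrix 1 U 0 0 = 1 := by
        simpa [Matrix.trace, orbitMatrix] using hP
      congr 1
      simp [Matrix.trace, Matrix.mul_apply, h1, symmOuter, vecMulVec_apply, PiLp.inner_apply]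
      ring
    have hp : (haarO 1).real Set.univ = 1 := by
      simp [Measure.real, haarO, ← TopologicalSpace.PositiveCompacts.coe_top,
        Measure.haarMeasure_self]
    simp [h, hp]
  · let i₁ : Fin d := ⟨1, by omega⟩
    have hi : i₀ ≠ i₁ := by simp [i₀, i₁]
    let A : orthogonalGroup (Fin d) ℝ → ℝ :=
      fun U => (orbitMatrix k U i₀ i₀ + orbitMatrix k U i₁ i₁) / 2
    let B : orthogonalGroup (Fin d) ℝ → ℝ :=
      fun U => (orbitMatrix k U i₀ i₀ - orbitMatrix k U i₁ i₁) / 2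
    have hAc : Continuous A :=
      ((continuous_orbitMatrix.matrix_elem _ _).add (continuous_orbitMatrix.matrix_elem _ _)).div_const _
    have hBc : Continuous B :=
      ((continuous_orbitMatrix.matrix_elem _ _).sub (continuous_orbitMatrix.matrix_elem _ _)).div_const _
    have hA0 : ∀ U, 0 ≤ A U := fun U =>
      div_nonneg (add_nonneg (orbitMatrix_apply_self_nonneg U _)
        (orbitMatrix_apply_self_nonneg U _)) zero_le_two
    have hA1 : 0 < A 1 :=
      div_pos (add_pos_of_pos_of_nonneg hpos (orbitMatrix_apply_self_nonneg _ _)) zero_lt_two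
    -- The trace is `⟪x, y⟫ * A + B`, expanded binomially. The top coefficient `∫ A ^ s` is positive
    -- as `A ≥ 0` is continuous with `A 1 > 0`.
    refine ⟨fun j => ∫ U, A U ^ j * B U ^ (s - j) * (s.choose j) ∂(haarO d), ?_, ?_, ?_⟩
    · refine Continuous.integral_pos_of_hasCompactSupport_nonneg_nonzero (x := 1) (by fun_prop)
        (HasCompactSupport.of_compactSpace _) (fun U => ?_) ?_
      · simpa using pow_nonneg (hA0 U) s
      · simpa using (pow_pos hA1 s).ne'
    · intro hs
      refine integral_nonneg fun U => ?_
      simpa using hs.pow_nonneg (B U)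
    · intro x y hx hy
      obtain ⟨V, hV⟩ := exists_symmOuter_eq_conj hi x y hx hy
      rw [hV, traceMoment_conj, traceMoment_eq]
      simp only [← integral_mul_const]
      rw [← integral_finsetSum]
      · congr 1
        funext U
        rw [Matrix.mul_sub, trace_sub, Matrix.mul_smul, Matrix.mul_smul, trace_smul, trace_smul,
          trace_mul_single, trace_mul_single]
        have : ((1 + inner ℝ x y) / 2) • orbitMatrix k U i₀ i₀ -
            ((1 - inner ℝ x y) / 2) • orbitMatrix k U i₁ i₁ = inner ℝ x y * A U + B U := by
          simp only [A, B, smul_eq_mul]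
          ring
        rw [this, add_pow]
        refine Finset.sum_congr rfl fun j _ => ?_
        rw [mul_pow]
        ring
      · intro j _
        exact Continuous.integrable_of_hasCompactSupport (by fun_prop)
          (HasCompactSupport.of_compactSpace _)

/-! ### Polarization -/

section Powers

/-- The coefficients of a polynomial curve contained in a subspace lie in that subspace. -/
theorem coeff_mem_of_forall_sum_pow_smul_mem {E : Type*} [AddCommGroup E] [Module ℝ E]
    (W : Submodule ℝ E) {n : ℕ} (c : Fin n → E)
    (h : ∀ r : ℝ, ∑ j : Fin n, r ^ (j : ℕ) • c j ∈ W) (j : Fin n) : c j ∈ W := by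
  -- Inverting the Vandermonde matrix at the nodes `0, …, n - 1` recovers the coefficients from
  -- values of the curve.
  let A : Matrix (Fin n) (Fin n) ℝ := vandermonde fun i => ((i : ℕ) : ℝ)
  have hA : IsUnit A.det := by
    rw [isUnit_iff_ne_zero, det_vandermonde_ne_zero_iff]
    intro i j hij
    exact Fin.ext (Nat.cast_injective hij)
  have hc : c j = ∑ i, A⁻¹ j i • ∑ l : Fin n, ((i : ℕ) : ℝ) ^ (l : ℕ) • c l := by
    have h1 : ∀ l : Fin n, ∑ i, A⁻¹ j i * ((i : ℕ) : ℝ) ^ (l : ℕ) = (1 : Matrix (Fin n) (Fin n) ℝ) j l := by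
      intro l
      rw [← nonsing_inv_mul A hA, Matrix.mul_apply]
      rfl
    simp_rw [Finset.smul_sum, smul_smul]
    rw [Finset.sum_comm]
    simp_rw [← Finset.sum_smul, h1, one_apply]
    simp
  rw [hc]
  exact W.sum_mem fun i _ => W.smul_mem _ (h _)

theorem pow_mul_pow_mem_of_forall_add_smul_pow_mem {R : Type*} [CommRing R] [Algebra ℝ R]
    (W : Submodule ℝ R) (u v : R) (p q : ℕ) (h : ∀ r : ℝ, (r • u + v) ^ (p + q) ∈ W) :
    u ^ p * v ^ q ∈ W := by
  have key := coeff_mem_of_forall_sum_pow_smul_mem W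
    (fun j : Fin (p + q + 1) => u ^ (j : ℕ) * v ^ (p + q - j) * ((p + q).choose j : R)) (by
      intro r
      have := h r
      rw [add_pow, Finset.sum_range] at this
      convert this using 2 with j
      rw [smul_pow, smul_mul_assoc, smul_mul_assoc]) ⟨p, by omega⟩
  have h2 := W.smul_mem (((p + q).choose p : ℝ)⁻¹) key
  have hne : ((p + q).choose p : ℝ) ≠ 0 := by
    exact_mod_cast (Nat.choose_pos (Nat.le_add_right p q)).ne'
  have hcast : (((p + q).choose p : ℕ) : R) = algebraMap ℝ R ((p + q).choose p : ℝ) := by simp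
  simp only [Nat.add_sub_cancel_left] at h2
  rw [hcast, mul_comm (u ^ p * v ^ q), ← Algebra.smul_def, smul_smul, inv_mul_cancel₀ hne,
    one_smul] at h2
  exact h2

/-- Monomials in elements of a subspace `L` of an algebra are combinations of powers of elements
of `L`. -/
theorem prod_pow_mem_span_pow {R ι : Type*} [CommRing R] [Algebra ℝ R] (L : Submodule ℝ R)
    (g : ι → R) (hg : ∀ i, g i ∈ L) (α : ι → ℕ) (S : Finset ι) :
    ∏ i ∈ S, g i ^ α i ∈ Submodule.span ℝ ((fun u => u ^ ∑ i ∈ S, α i) '' (L : Set R)) := by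
  classical
  induction S using Finset.induction_on with
  | empty => exact Submodule.subset_span ⟨0, L.zero_mem, by simp⟩
  | insert i S hi ih =>
    rw [Finset.prod_insert hi, Finset.sum_insert hi]
    set W := Submodule.span ℝ ((fun u => u ^ (α i + ∑ i ∈ S, α i)) '' (L : Set R)) with hW
    -- Multiplication by `g i ^ α i` is linear, so pure powers suffice.
    have hle : Submodule.span ℝ ((fun u => u ^ ∑ i ∈ S, α i) '' (L : Set R)) ≤
        W.comap (LinearMap.mulLeft ℝ (g i ^ α i)) := by
      rw [Submodule.span_le]
      rintro _ ⟨v, hv, rfl⟩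
      simp only [SetLike.mem_coe, Submodule.mem_comap, LinearMap.mulLeft_apply]
      refine pow_mul_pow_mem_of_forall_add_smul_pow_mem W _ _ _ _ fun r => ?_
      exact Submodule.subset_span ⟨_, L.add_mem (L.smul_mem r (hg i)) hv, rfl⟩
    exact hle ih

end Powers

/-! ### Inverting the triangular system -/

section Span

variable {k d : ℕ}

/-- The function `x ↦ ⟪x, y⟫` on the unit sphere, as a linear map in `y`. -/
noncomputable def sphereInner (d : ℕ) :
    EuclideanSpace ℝ (Fin d) →ₗ[ℝ] (Metric.sphere (0 : EuclideanSpace ℝ (Fin d)) 1 → ℝ) where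
  toFun y x := inner ℝ (x : EuclideanSpace ℝ (Fin d)) y
  map_add' y z := by ext x; simp [inner_add_right]
  map_smul' r y := by ext x; simp [inner_smul_right]

/-- The span of the functions `x ↦ μ^s(E_{x,y})` with `1 ≤ s ≤ t` and `y` in the sphere. -/
noncomputable def momentSpan (hkd : k ≤ d) (t : ℕ) :
    Submodule ℝ (Metric.sphere (0 : EuclideanSpace ℝ (Fin d)) 1 → ℝ) :=
  Submodule.span ℝ (Set.range
    fun p : Finset.Icc 1 t × Metric.sphere (0 : EuclideanSpace ℝ (Fin d)) 1 =>
      fun x => traceMoment hkd p.1 (symmOuter x p.2))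

theorem sum_sphereInner_pow_mem (hkd : k ≤ d) {s t : ℕ} (hs : 1 ≤ s) (hst : s ≤ t)
    {y : EuclideanSpace ℝ (Fin d)} (hy : ‖y‖ = 1) {a : ℕ → ℝ}
    (ha : ∀ x y : EuclideanSpace ℝ (Fin d), ‖x‖ = 1 → ‖y‖ = 1 →
        traceMoment hkd s (symmOuter x y) =
          ∑ j ∈ Finset.range (s + 1), a j * (inner ℝ x y) ^ j) :
    ∑ j ∈ Finset.range (s + 1), a j • sphereInner d y ^ j ∈ momentSpan hkd t := by
  refine Submodule.subset_span ⟨(⟨s, Finset.mem_Icc.2 ⟨hs, hst⟩⟩, ⟨y, by simpa using hy⟩), ?_⟩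
  ext x
  simp [ha x y (by simp) hy, sphereInner, Finset.sum_apply]

theorem one_mem_momentSpan (hk : 1 ≤ k) (hkd : k ≤ d) {t : ℕ} (ht : 2 ≤ t) :
    1 ∈ momentSpan hkd t := by
  obtain ⟨a, ha2, ha0, ha⟩ := exists_traceMoment_symmOuter_eq hk hkd 2
  let e : Fin d → EuclideanSpace ℝ (Fin d) := fun i => EuclideanSpace.single i 1
  have he : ∀ i, ‖e i‖ = 1 := fun i => by simp [e]
  -- Antipodal pairs cancel the linear term; summing over the basis turns the squares into `1`.
  have hmem : ∑ i, ((∑ j ∈ Finset.range 3, a j • sphereInner d (e i) ^ j) +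
      ∑ j ∈ Finset.range 3, a j • sphereInner d (-e i) ^ j) ∈ momentSpan hkd t :=
    Submodule.sum_mem _ fun i _ => Submodule.add_mem _
      (sum_sphereInner_pow_mem hkd one_le_two ht (he i) ha)
      (sum_sphereInner_pow_mem hkd one_le_two ht (by rw [norm_neg, he i]) ha)
  have hd : (1 : ℝ) ≤ d := by exact_mod_cast hk.trans hkd
  -- Nonnegativity of `a 0` excludes cancellation with `a 2`.
  have hne : 2 * (a 2 + d * a 0) ≠ 0 := by
    have := ha0 even_two
    positivity
  have heq : (2 * (a 2 + d * a 0)) • (1 : Metric.sphere (0 : EuclideanSpace ℝ (Fin d)) 1 → ℝ) =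
      ∑ i, ((∑ j ∈ Finset.range 3, a j • sphereInner d (e i) ^ j) +
      ∑ j ∈ Finset.range 3, a j • sphereInner d (-e i) ^ j) := by
    ext x
    have hx : ∑ i, x.1 i ^ 2 = 1 := by
      rw [← EuclideanSpace.real_norm_sq_eq]
      simp
    have h1 : ∀ i, sphereInner d (e i) x = x.1 i := fun i => by
      simp [sphereInner, e, EuclideanSpace.inner_single_right]
    have : ∀ i, (∑ j ∈ Finset.range 3, a j • sphereInner d (e i) ^ j +
        ∑ j ∈ Finset.range 3, a j • sphereInner d (-e i) ^ j) x =
        2 * a 0 + 2 * a 2 * x.1 i ^ 2 := fun i => by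
      simp [Finset.sum_range_succ, h1]
      ring
    rw [Finset.sum_apply]
    simp_rw [this]
    rw [Finset.sum_add_distrib, ← Finset.mul_sum Finset.univ _ (2 * a 2), hx]
    simp
    ring
  rw [← heq] at hmem
  exact (Submodule.smul_mem_iff _ hne).1 hmem

theorem sphereInner_pow_mem_momentSpan (hk : 1 ≤ k) (hkd : k ≤ d) {t : ℕ} (s : ℕ) (hs : 1 ≤ s)
    (hst : s ≤ t) {y : EuclideanSpace ℝ (Fin d)} (hy : ‖y‖ = 1) :
    sphereInner d y ^ s ∈ momentSpan hkd t := by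
  induction s using Nat.strong_induction_on with
  | _ s ih =>
    obtain ⟨a, has, -, ha⟩ := exists_traceMoment_symmOuter_eq hk hkd s
    have hmem := sum_sphereInner_pow_mem hkd hs hst hy ha
    rcases hs.eq_or_lt with rfl | hs2
    -- For `s = 1`, `t` may be `1`, where `one_mem_momentSpan` does not apply; antipodal subtraction
    -- removes the constant instead.
    · have hmem' := sum_sphereInner_pow_mem hkd hs hst (y := -y) (by rwa [norm_neg]) ha
      have h := Submodule.sub_mem _ hmem hmem'
      have heq : (∑ j ∈ Finset.range (1 + 1), a j • sphereInner d y ^ j -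
          ∑ j ∈ Finset.range (1 + 1), a j • sphereInner d (-y) ^ j) =
          (2 * a 1) • sphereInner d y ^ 1 := by
        ext x
        simp [Finset.sum_range_succ]
        ring
      rw [heq] at h
      exact (Submodule.smul_mem_iff _ (by positivity)).1 h
    · rw [Finset.sum_range_succ] at hmem
      refine (Submodule.smul_mem_iff _ has.ne').1 ((Submodule.add_mem_iff_right _ ?_).1 hmem)
      refine Submodule.sum_mem _ fun j hj => Submodule.smul_mem _ _ ?_
      rw [Finset.mem_range] at hj
      rcases Nat.eq_zero_or_pos j with rfl | hj0
      · rw [pow_zero]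
        exact one_mem_momentSpan hk hkd (by omega)
      · exact ih j hj hj0 (by omega)

theorem monomial_mem_momentSpan (hk : 1 ≤ k) (hkd : k ≤ d) {t : ℕ} (ht : 1 ≤ t) (α : Fin d → ℕ)
    (hα : ∑ i, α i = t) :
    (fun x : Metric.sphere (0 : EuclideanSpace ℝ (Fin d)) 1 => ∏ j, x.1 j ^ α j) ∈
      momentSpan hkd t := by
  have h := prod_pow_mem_span_pow (LinearMap.range (sphereInner d))
    (fun i => sphereInner d (EuclideanSpace.single i 1)) (fun i => ⟨_, rfl⟩) α Finset.univ
  have heq : ∏ i, sphereInner d (EuclideanSpace.single i 1) ^ α i =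
      fun x : Metric.sphere (0 : EuclideanSpace ℝ (Fin d)) 1 => ∏ j, x.1 j ^ α j := by
    ext x
    simp [sphereInner, EuclideanSpace.inner_single_right]
  rw [heq, hα] at h
  refine (Submodule.span_le.2 ?_) h
  rintro _ ⟨_, ⟨y, rfl⟩, rfl⟩
  simp only [SetLike.mem_coe]
  by_cases hy : y = 0
  · rw [hy, map_zero, zero_pow (by omega)]
    exact Submodule.zero_mem _
  · have hy' : sphereInner d y = ‖y‖ • sphereInner d (‖y‖⁻¹ • y) := by
      rw [← map_smul, smul_smul, mul_inv_cancel₀ (norm_ne_zero_iff.2 hy), one_smul]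
    rw [hy', smul_pow]
    refine Submodule.smul_mem _ _ (sphereInner_pow_mem_momentSpan hk hkd t ht le_rfl ?_)
    simp [norm_smul, hy]

theorem exists_eq_sum_of_mem_momentSpan (hkd : k ≤ d) {t : ℕ}
    {g : Metric.sphere (0 : EuclideanSpace ℝ (Fin d)) 1 → ℝ} (hg : g ∈ momentSpan hkd t) :
    ∃ (m : ℕ) (y : ℕ → Fin m → Metric.sphere (0 : EuclideanSpace ℝ (Fin d)) 1)
      (f : ℕ → Fin m → ℝ), ∀ x, g x = ∑ s ∈ Finset.Icc 1 t, ∑ i : Fin m,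
        f s i * traceMoment hkd s (symmOuter (x : EuclideanSpace ℝ (Fin d)) (y s i)) := by
  obtain ⟨c, hc⟩ := Finsupp.mem_span_range_iff_exists_finsupp.1 hg
  let e := c.support.equivFin.symm
  -- One list of points serves every `s`; the coefficient is zero unless `s` is the exponent
  -- attached to `i`.
  refine ⟨c.support.card, fun _ i => (e i).1.2,
    fun s i => if s = (e i).1.1 then c (e i) else 0, fun x => ?_⟩
  rw [← hc, Finset.sum_comm, Finsupp.sum, Finset.sum_apply, ← Finset.sum_coe_sort,
    ← e.sum_comp]
  refine Finset.sum_congr rfl fun i _ => ?_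
  have hmem : ((e i).1.1 : ℕ) ∈ Finset.Icc 1 t := (e i).1.1.2
  simp only [ite_mul, zero_mul, Finset.sum_ite_eq', hmem, if_true]
  rfl

end Span

end GrassmannMoment

theorem theorem2p1 (k d : ℕ) (hk : 1 ≤ k) (hkd : k ≤ d) (t : ℕ) (ht : 1 ≤ t)
    (α : Fin d → ℕ) (hα : ∑ i, α i = t) :
    ∃ (m : ℕ) (y : ℕ → Fin m → Metric.sphere (0 : EuclideanSpace ℝ (Fin d)) 1)
      (f : ℕ → Fin m → ℝ),
      ∀ x : Metric.sphere (0 : EuclideanSpace ℝ (Fin d)) 1,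
        ∏ j, (x : EuclideanSpace ℝ (Fin d)) j ^ α j =
          ∑ s ∈ Finset.Icc 1 t, ∑ i : Fin m,
            f s i * GrassmannMoment.traceMoment hkd s
              (GrassmannMoment.symmOuter (x : EuclideanSpace ℝ (Fin d)) (y s i)) :=
  GrassmannMoment.exists_eq_sum_of_mem_momentSpan hkd
    (GrassmannMoment.monomial_mem_momentSpan hk hkd ht α hα)
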